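/- Let $\mathbb K$ be a field, let $Q$ be the equioriented quiver $x_0 \to x_1 \to \cdots \to x_{n-1}$ of type $\mathbb A_n$, and let $V$ be a nonzero finite-dimensional representation of $Q$ over $\mathbb K$. For $0 \le u \le v \le n-1$ let $\mathbf I[u,v]$ be the interval module: it is $\mathbb K$ at $x_i$ for $u \le i \le v$ and $0$ elsewhere, with identity maps between consecutive copies of $\mathbb K$ and zero maps otherwise. Let $\alpha : \{x_0,\dots,x_{n-1}\} \to \mathbb R$ be a stability condition, with slope $$\phi_\alpha(W) = \frac{\sum_i \alpha_{x_i} \dim W_{x_i}}{\sum_i \dim W_{x_i}} \qquad (W \ne 0).$$ A nonzero $W$ is semistable if $\phi_\alpha(U) \le \phi_\alpha(W)$ for every nonzero subrepresentation $U \subset W$. A Harder–Narasimhan (HN) filtration of $V$ is a filtration $0 = V^0 \subsetneq V^1 \subsetneq \cdots \subsetneq V^\ell = V$ by subrepresentations whose quotients $V^j/V^{j-1}$ are semistable with strictly decreasing slopes. Its re-indexing by the real line is $V_{\mathbb R}(t) := V^i$, where $i \ge 0$ is the smallest index with $i = \ell$ or $\phi_\alpha(V^{i+1}/V^i) < t$.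 Assume that $\phi_\alpha$ is antitone, i.e. $\phi_\alpha(\mathbf I[u,v]) \ge \phi_\alpha(\mathbf I[u',v'])$ whenever $u < u'$, or $u = u'$ and $v \le v'$. Then $V$ has a decomposition $$V \simeq \bigoplus_{[u,v]} \mathbf I[u,v]^{d_{uv}} \qquad (*)$$ and an HN filtration, and for every decomposition $(*)$ and every HN filtration $V^\bullet$ of $V$ the following hold. 1. For each $t \in \mathbb R$, $$V_{\mathbb R}(t) \simeq \bigoplus_{[u,v]\,:\ \phi_\alpha(\mathbf I[u,v]) \ge t} \mathbf I[u,v]^{d_{uv}},$$ and such an isomorphism is obtained by restricting the isomorphism $(*)$ to $V_{\mathbb R}(t) \subset V$. 2. For each $j \in \{1,\dots,\ell\}$, $$V^j/V^{j-1} \simeq \bigoplus_{[u,v]\,:\ \phi_\alpha(\mathbf I[u,v]) = \phi_\alpha(V^j/V^{j-1})} \mathbf I[u,v]^{d_{uv}}.$$ -/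

import Mathlib

universe u v w w'

/-- A finite-dimensional representation of a quiver `Q` over a field `K`. -/
structure QuiverRep (K : Type u) [Field K] (Q : Type v) [Quiver Q] where
  /-- the vector space at a vertex -/
  space : Q → Type w
  [addCommGroup : ∀ x, AddCommGroup (space x)]
  [module : ∀ x, Module K (space x)]
  [finiteDimensional : ∀ x, FiniteDimensional K (space x)]
  /-- the linear map along an edge -/
  map : ∀ {x y : Q}, (x ⟶ y) → (space x →ₗ[K] space y)

namespace QuiverRep

attribute [instance] QuiverRep.addCommGroup QuiverRep.module QuiverRep.finiteDimensional

section General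

variable {K : Type u} [Field K] {Q : Type v} [Quiver Q]

/-- A representation is nonzero if one of its vector spaces is nonzero. -/
def IsNonzero (V : QuiverRep.{u, v, w} K Q) : Prop :=
  ∃ x, Nontrivial (V.space x)

/-- Morphisms of representations. -/
structure Hom (V : QuiverRep.{u, v, w} K Q) (W : QuiverRep.{u, v, w'} K Q) where
  /-- the linear map at a vertex -/
  app : ∀ x, V.space x →ₗ[K] W.space x
  naturality : ∀ {x y : Q} (e : x ⟶ y) (a : V.space x),
    app y (V.map e a) = W.map e (app x a)

/-- Isomorphisms of representations. -/
structure Iso (V : QuiverRep.{u, v, w} K Q) (W : QuiverRep.{u, v, w'} K Q) where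
  /-- the linear isomorphism at a vertex -/
  app : ∀ x, V.space x ≃ₗ[K] W.space x
  naturality : ∀ {x y : Q} (e : x ⟶ y) (a : V.space x),
    app y (V.map e a) = W.map e (app x a)

/-- The direct sum of a finite family of representations, formed vertexwise (a finite direct sum
of vector spaces is their product). -/
def directSum {ι : Type} [Finite ι] (W : ι → QuiverRep.{u, v, w} K Q) : QuiverRep.{u, v, w} K Q where
  space x := ∀ i, (W i).space x
  map e := LinearMap.pi fun i => (W i).map e ∘ₗ LinearMap.proj i

open Classical in
/-- The inclusion of the direct sum of those summands whose index satisfies `P` into the direct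
sum of the whole family: the components at the other indices are zero. -/
noncomputable def directSumIncl {ι : Type} [Finite ι] (W : ι → QuiverRep.{u, v, w} K Q)
    (P : ι → Prop) : Hom (directSum fun i : {i // P i} => W i) (directSum W) where
  app x :=
    { toFun := fun f i => if h : P i then f ⟨i, h⟩ else 0
      map_add' := fun f g => by
        funext i
        change (if h : P i then f ⟨i, h⟩ + g ⟨i, h⟩ else (0 : (W i).space x)) =
          (if h : P i then f ⟨i, h⟩ else (0 : (W i).space x)) +
            (if h : P i then g ⟨i, h⟩ else (0 : (W i).space x))
        split <;> simp
      map_smul' := fun c f => by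
        funext i
        change (if h : P i then c • f ⟨i, h⟩ else (0 : (W i).space x)) =
          c • (if h : P i then f ⟨i, h⟩ else (0 : (W i).space x))
        split <;> simp }
  naturality {x y} e a := by
    funext i
    change (if h : P i then (W i).map e (a ⟨i, h⟩) else 0) =
      (W i).map e (if h : P i then a ⟨i, h⟩ else 0)
    split <;> simp

/-- Subrepresentations: families of subspaces preserved by the maps along the edges. -/
@[ext]
structure Subrep (V : QuiverRep.{u, v, w} K Q) where
  /-- the subspace at a vertex -/
  sub : ∀ x, Submodule K (V.space x)
  map_mem : ∀ {x y : Q} (e : x ⟶ y) (a : V.space x), a ∈ sub x → V.map e a ∈ sub y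

namespace Subrep

variable {V : QuiverRep.{u, v, w} K Q}

/-- Subrepresentations are ordered by vertexwise inclusion. -/
instance : PartialOrder (Subrep V) :=
  PartialOrder.lift (fun U : Subrep V => U.sub) fun _ _ h => Subrep.ext h

instance : Bot (Subrep V) :=
  ⟨{ sub := fun _ => ⊥
     map_mem := fun e a h => by
      rw [(Submodule.mem_bot K).1 h, map_zero]
      exact Submodule.zero_mem _ }⟩

instance : Top (Subrep V) :=
  ⟨{ sub := fun _ => ⊤
     map_mem := fun _ _ _ => Submodule.mem_top }⟩

/-- A subrepresentation, as a representation. -/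
def toRep (U : Subrep V) : QuiverRep.{u, v, w} K Q where
  space x := U.sub x
  map e := (V.map e).restrict (fun a ha => U.map_mem e a ha)

/-- The inclusion of a subrepresentation. -/
def incl (U : Subrep V) : Hom U.toRep V where
  app x := (U.sub x).subtype
  naturality _ _ := rfl

/-- The quotient `W / U` of two subrepresentations `U ≤ W` of `V`. -/
def quotient (W U : Subrep V) : QuiverRep.{u, v, w} K Q where
  space x := W.sub x ⧸ (U.sub x).submoduleOf (W.sub x)
  map e := Submodule.mapQ _ _ (W.toRep.map e) (fun a ha => U.map_mem e a.1 ha)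

end Subrep

/-! Slopes, semistability and Harder-Narasimhan filtrations. -/

variable [Fintype Q]

/-- The slope of a (nonzero) representation for the stability condition `α`. -/
noncomputable def slope (α : Q → ℝ) (V : QuiverRep.{u, v, w} K Q) : ℝ :=
  (∑ x, α x * (Module.finrank K (V.space x) : ℝ)) / ∑ x, (Module.finrank K (V.space x) : ℝ)

/-- A representation is semistable if it is nonzero and no nonzero subrepresentation has larger
slope. -/
def IsSemistable (α : Q → ℝ) (V : QuiverRep.{u, v, w} K Q) : Prop :=
  V.IsNonzero ∧ ∀ U : Subrep V, U ≠ ⊥ → slope α U.toRep ≤ slope α V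

/-- A Harder-Narasimhan filtration `0 = V⁰ ⊊ V¹ ⊊ ⋯ ⊊ V^ℓ = V`: the successive quotients
`V^(j+1) / V^j` are semistable with strictly decreasing slopes. -/
structure HNFiltration (α : Q → ℝ) (V : QuiverRep.{u, v, w} K Q) where
  /-- the length `ℓ` -/
  length : ℕ
  /-- the terms `V⁰, …, V^ℓ` -/
  step : Fin (length + 1) → Subrep V
  step_zero : step 0 = ⊥
  step_last : step (Fin.last length) = ⊤
  strictMono : StrictMono step
  semistable : ∀ j : Fin length, IsSemistable α ((step j.succ).quotient (step j.castSucc))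
  slope_strictAnti :
    StrictAnti fun j : Fin length => slope α ((step j.succ).quotient (step j.castSucc))

namespace HNFiltration

variable {α : Q → ℝ} {V : QuiverRep.{u, v, w} K Q}

/-- The successive quotient `V^(j+1) / V^j`, for `0 ≤ j < ℓ`. -/
def quot (F : HNFiltration α V) (j : Fin F.length) : QuiverRep.{u, v, w} K Q :=
  (F.step j.succ).quotient (F.step j.castSucc)

theorem exists_index (F : HNFiltration α V) (t : ℝ) :
    ∃ i : ℕ, ∀ h : i < F.length, slope α (F.quot ⟨i, h⟩) < t :=
  ⟨F.length, fun h => absurd h (lt_irrefl _)⟩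

open Classical in
/-- The smallest `i ≥ 0` such that the slope of `V^(i+1) / V^i` is less than `t`; it is `ℓ` if
there is no such `i < ℓ`. -/
noncomputable def index (F : HNFiltration α V) (t : ℝ) : ℕ :=
  Nat.find (F.exists_index t)

theorem index_lt (F : HNFiltration α V) (t : ℝ) : F.index t < F.length + 1 := by
  classical
  exact Nat.lt_succ_of_le (Nat.find_min' (F.exists_index t) fun h => absurd h (lt_irrefl _))

/-- The filtration re-indexed by the real line. -/
noncomputable def real (F : HNFiltration α V) (t : ℝ) : Subrep V :=
  F.step ⟨F.index t, F.index_lt t⟩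

end HNFiltration

end General

end QuiverRep

/-- The vertices `x_0, …, x_(n-1)` of the equioriented quiver of type `A_n`. -/
def EquiorientedA (n : ℕ) : Type := Fin n

namespace EquiorientedA

instance (n : ℕ) : Fintype (EquiorientedA n) := inferInstanceAs (Fintype (Fin n))

/-- There is exactly one edge `x_i ⟶ x_(i+1)` for each `i` with `i + 1 < n`, and no other edge. -/
instance (n : ℕ) : Quiver.{0} (EquiorientedA n) where
  Hom i j := PLift (Fin.val (n := n) i + 1 = Fin.val (n := n) j)

end EquiorientedA

namespace QuiverRep

section TypeA

instance (n : ℕ) : Finite (NonemptyInterval (Fin n)) :=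
  Finite.of_injective (fun I => I.toProd) NonemptyInterval.toProd_injective

variable (K : Type u) [Field K] {n : ℕ}

/-- The vertex `x_i` lies in the interval `[u, v]`. -/
def Inside (I : NonemptyInterval (Fin n)) (i : EquiorientedA n) : Prop :=
  I.fst ≤ (show Fin n from i) ∧ (show Fin n from i) ≤ I.snd

open Classical in
/-- The interval module `I[u, v]`. Its space at `x_i` consists of the functions to `K` from a
one-point set if `u ≤ i ≤ v`, and from the empty set otherwise: it is `K` in the first case and
`0` in the second. The map along an edge is the identity of `K` if source and target both lie in
the interval, and zero otherwise. -/
noncomputable def intervalModule (I : NonemptyInterval (Fin n)) :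
    QuiverRep.{u, 0, u} K (EquiorientedA n) where
  space i := PLift (Inside I i) → K
  map {i _} _ := LinearMap.pi fun _ =>
    if h : Inside I i then LinearMap.proj (PLift.up h) else 0

/-- The lexicographic order on intervals. -/
def IntervalLex (I J : NonemptyInterval (Fin n)) : Prop :=
  I.fst < J.fst ∨ (I.fst = J.fst ∧ I.snd ≤ J.snd)

/-- The slope of `α` is antitone: it reverses the lexicographic order on interval modules. -/
def IsAntitoneSlope (α : EquiorientedA n → ℝ) : Prop :=
  ∀ I J : NonemptyInterval (Fin n), IntervalLex I J →
    slope α (intervalModule K J) ≤ slope α (intervalModule K I)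

variable {K}

/-- A barcode decomposition of `V`: multiplicities `d` (zero for intervals outside the barcode)
and an isomorphism of `V` with the direct sum of the `I[u, v] ^ d_uv`. The summands are indexed
by pairs of an interval and an element of `{0, …, d_uv - 1}`. -/
structure BarcodeDecomposition (V : QuiverRep.{u, 0, w} K (EquiorientedA n)) where
  /-- the multiplicities -/
  d : NonemptyInterval (Fin n) → ℕ
  /-- the isomorphism -/
  iso : Iso V (directSum fun p : (Σ I : NonemptyInterval (Fin n), Fin (d I)) =>
    intervalModule K p.1)

end TypeA

end QuiverRep

-- The theorem rests on two facts: interval modules are semistable when the slope is antitone, and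
-- there are no nonzero morphisms from a semistable representation to one of smaller slope
-- (`Hom.app_eq_zero_of_lt`).
--
-- Semistability holds because a nonzero subrepresentation of `I[u, v]` is closed under the identity
-- maps to the right, so it has the dimension vector, hence the slope, of some `I[w, v]` with `u ≤
-- w` (`isSemistable_intervalModule`).
--
-- Given any decomposition into semistable summands and any HN filtration, the vanishing of
-- morphisms applies both to maps from the filtration quotients to the summands and to maps from the
-- summands to the quotients. It forces each term of the filtration to equal, as a subspace, the sum
-- of the summands whose slope lies in an upper set (`HNFiltration.step_eq_partSum`). Both claims
-- follow by choosing the upper set, with no appeal to uniqueness of the HN filtration or of the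
-- barcode. Conversely, grouping summands by slope constructs an HN filtration
-- (`nonempty_hnFiltration_of_iso`).
--
-- A barcode exists because every nonzero representation has an interval module starting at its
-- leftmost nonzero vertex as a retract (`exists_intervalModule_retract`). Splitting it off lowers
-- the total dimension.

universe z

namespace QuiverRep

/-! ### Morphisms, quotients, and partial sums of a direct sum decomposition. -/

section Morphisms

variable {K : Type u} [Field K] {Q : Type v} [Quiver Q]

/-- Composition of morphisms. -/
def Hom.comp {U : QuiverRep.{u, v, w} K Q} {V : QuiverRep.{u, v, w'} K Q}
    {W : QuiverRep.{u, v, z} K Q} (g : Hom V W) (f : Hom U V) : Hom U W where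
  app x := g.app x ∘ₗ f.app x
  naturality e a := by simp [f.naturality, g.naturality]

/-- An isomorphism, as a morphism. -/
def Iso.toHom {V : QuiverRep.{u, v, w} K Q} {W : QuiverRep.{u, v, w'} K Q} (φ : Iso V W) :
    Hom V W where
  app x := (φ.app x).toLinearMap
  naturality e a := φ.naturality e a

/-- The inverse isomorphism. -/
def Iso.symm {V : QuiverRep.{u, v, w} K Q} {W : QuiverRep.{u, v, w'} K Q} (φ : Iso V W) :
    Iso W V where
  app x := (φ.app x).symm
  naturality e a := by
    rw [LinearEquiv.symm_apply_eq, φ.naturality, LinearEquiv.apply_symm_apply]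

/-- A vertexwise bijective morphism is an isomorphism. -/
noncomputable def Iso.ofBijective {V : QuiverRep.{u, v, w} K Q} {W : QuiverRep.{u, v, w'} K Q}
    (f : Hom V W) (hf : ∀ x, Function.Bijective (f.app x)) : Iso V W where
  app x := LinearEquiv.ofBijective (f.app x) (hf x)
  naturality e a := f.naturality e a

section DirectSum

variable {ι : Type} [Finite ι] (W : ι → QuiverRep.{u, v, w} K Q)

/-- The projection of a direct sum onto a summand. -/
def directSumProj (i : ι) : Hom (directSum W) (W i) where
  app x := (LinearMap.proj i : (∀ i, (W i).space x) →ₗ[K] (W i).space x)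
  naturality _ _ := rfl

open Classical in
/-- The inclusion of a summand into a direct sum. -/
noncomputable def directSumSingle (i : ι) : Hom (W i) (directSum W) where
  app x := (LinearMap.single K (fun i => (W i).space x) i :
    (W i).space x →ₗ[K] (∀ i, (W i).space x))
  naturality {x y} e a := by
    funext j
    change Pi.single (M := fun i => (W i).space y) i ((W i).map e a) j =
      (W j).map e (Pi.single (M := fun i => (W i).space x) i a j)
    by_cases h : j = i
    · subst h; simp
    · simp [h]

variable {W}

/-- The morphism into a direct sum with given components. -/
def directSumLift {V : QuiverRep.{u, v, w'} K Q} (f : ∀ i, Hom V (W i)) :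
    Hom V (directSum W) where
  app x := (LinearMap.pi fun i => (f i).app x : V.space x →ₗ[K] (∀ i, (W i).space x))
  naturality e a := funext fun i => (f i).naturality e a

open Classical in
theorem directSumProj_single_self (i : ι) (x : Q) (a : (W i).space x) :
    (directSumProj W i).app x ((directSumSingle W i).app x a) = a :=
  Pi.single_eq_same (M := fun i => (W i).space x) i a

open Classical in
theorem directSumProj_single_of_ne {i j : ι} (h : j ≠ i) (x : Q) (a : (W i).space x) :
    (directSumProj W j).app x ((directSumSingle W i).app x a) = 0 :=
  Pi.single_eq_of_ne (M := fun i => (W i).space x) h a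

theorem directSum_ext {x : Q} {a b : (directSum W).space x}
    (h : ∀ i, (directSumProj W i).app x a = (directSumProj W i).app x b) : a = b :=
  funext h

theorem directSum_mem_of_single {x : Q} (S : Submodule K ((directSum W).space x))
    (a : (directSum W).space x)
    (h : ∀ i, (directSumSingle W i).app x ((directSumProj W i).app x a) ∈ S) : a ∈ S := by
  classical
  have := Fintype.ofFinite ι
  have e : a = ∑ i, (directSumSingle W i).app x ((directSumProj W i).app x a) := by
    refine directSum_ext fun j => ?_
    rw [map_sum, Finset.sum_eq_single j, directSumProj_single_self]
    · intro i _ hij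
      exact directSumProj_single_of_ne (Ne.symm hij) x _
    · intro hj
      exact absurd (Finset.mem_univ j) hj
  rw [e]
  exact Submodule.sum_mem _ fun i _ => h i

end DirectSum

namespace Subrep

variable {V : QuiverRep.{u, v, w} K Q} {W : QuiverRep.{u, v, w'} K Q}

theorem ne_bot_iff (U : Subrep V) : U ≠ ⊥ ↔ U.toRep.IsNonzero := by
  constructor
  · intro h
    by_contra hn
    refine h (Subrep.ext (funext fun x => ?_))
    have : ¬ Nontrivial (U.sub x) := fun hx => hn ⟨x, hx⟩
    rwa [Submodule.nontrivial_iff_ne_bot, not_not] at this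
  · rintro ⟨x, hx⟩ rfl
    exact (Submodule.nontrivial_iff_ne_bot.1 hx) rfl

/-- The image of a subrepresentation under a morphism. -/
def map (f : Hom V W) (U : Subrep V) : Subrep W where
  sub x := (U.sub x).map (f.app x)
  map_mem e a ha := by
    obtain ⟨b, hb, rfl⟩ := ha
    exact ⟨V.map e b, U.map_mem e b hb, f.naturality e b⟩

/-- The elements of a subrepresentation that a morphism sends to zero. -/
def infKer (f : Hom V W) (U : Subrep V) : Subrep V where
  sub x := U.sub x ⊓ LinearMap.ker (f.app x)
  map_mem e a ha := by
    refine ⟨U.map_mem e a ha.1, ?_⟩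
    have : f.app _ a = 0 := ha.2
    rw [SetLike.mem_coe, LinearMap.mem_ker, f.naturality, this, map_zero]

/-- The projection of `W` onto `W / U`. -/
def quotientMk (W U : Subrep V) : Hom W.toRep (W.quotient U) where
  app x := ((U.sub x).submoduleOf (W.sub x)).mkQ
  naturality _ _ := rfl

theorem quotientMk_eq_zero_iff {W U : Subrep V} {x : Q} (a : W.toRep.space x) :
    (quotientMk W U).app x a = 0 ↔ W.incl.app x a ∈ U.sub x :=
  Submodule.Quotient.mk_eq_zero _

theorem quotientMk_surjective (W U : Subrep V) (x : Q) :
    Function.Surjective ((quotientMk W U).app x) :=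
  Submodule.mkQ_surjective _

/-- A morphism from `W` that vanishes on `U` factors through `W / U`. -/
def quotientLift (W U : Subrep V) {Z : QuiverRep.{u, v, w'} K Q} (f : Hom W.toRep Z)
    (hf : ∀ x (a : W.toRep.space x), W.incl.app x a ∈ U.sub x → f.app x a = 0) :
    Hom (W.quotient U) Z where
  app x := ((U.sub x).submoduleOf (W.sub x)).liftQ (f.app x) (hf x)
  naturality {x y} e a := by
    obtain ⟨b, rfl⟩ := quotientMk_surjective W U x a
    exact f.naturality e b

/-- A morphism whose values lie in a subrepresentation, as a morphism to it. -/
def codRestrict (U : Subrep V) (f : Hom W V) (hf : ∀ x a, f.app x a ∈ U.sub x) :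
    Hom W U.toRep where
  app x := (f.app x).codRestrict (U.sub x) (hf x)
  naturality e a := Subtype.ext (f.naturality e a)

end Subrep

section PartSum

variable {ι : Type} [Finite ι] {W : ι → QuiverRep.{u, v, w'} K Q} {V : QuiverRep.{u, v, w} K Q}

/-- The component of a direct sum decomposition at an index. -/
def Iso.coord (φ : Iso V (directSum W)) (i : ι) : Hom V (W i) :=
  (directSumProj W i).comp φ.toHom

/-- The inclusion of a summand of a direct sum decomposition. -/
noncomputable def Iso.single (φ : Iso V (directSum W)) (i : ι) : Hom (W i) V :=
  φ.symm.toHom.comp (directSumSingle W i)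

theorem Iso.coord_single_of_ne (φ : Iso V (directSum W)) {i j : ι} (h : j ≠ i) (x : Q)
    (a : (W i).space x) : (φ.coord j).app x ((φ.single i).app x a) = 0 := by
  change (directSumProj W j).app x (φ.app x ((φ.app x).symm ((directSumSingle W i).app x a))) = 0
  rw [LinearEquiv.apply_symm_apply, directSumProj_single_of_ne h]

theorem Iso.ext_coord (φ : Iso V (directSum W)) {x : Q} {a b : V.space x}
    (h : ∀ i, (φ.coord i).app x a = (φ.coord i).app x b) : a = b :=
  (φ.app x).injective (directSum_ext h)

theorem Iso.exists_coord_eq (φ : Iso V (directSum W)) (x : Q) (f : (directSum W).space x) :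
    ∃ a, ∀ i, (φ.coord i).app x a = f i := by
  refine ⟨(φ.app x).symm f, fun i => ?_⟩
  change (directSumProj W i).app x (φ.app x ((φ.app x).symm f)) = f i
  rw [LinearEquiv.apply_symm_apply]
  rfl

theorem Iso.mem_of_single (φ : Iso V (directSum W)) {x : Q} (S : Submodule K (V.space x))
    (a : V.space x) (h : ∀ i, (φ.single i).app x ((φ.coord i).app x a) ∈ S) : a ∈ S := by
  have := directSum_mem_of_single (S.comap (φ.app x).symm.toLinearMap) (φ.app x a) h
  simpa using this

/-- The sum of the summands whose index satisfies `P`. -/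
def Iso.partSum (φ : Iso V (directSum W)) (P : ι → Prop) : Subrep V where
  sub x := ⨅ i, ⨅ _ : ¬ P i, LinearMap.ker ((φ.coord i).app x)
  map_mem e a ha := by
    simp only [Submodule.mem_iInf, LinearMap.mem_ker] at ha ⊢
    intro i hi
    rw [(φ.coord i).naturality, ha i hi, map_zero]

theorem Iso.mem_partSum (φ : Iso V (directSum W)) {P : ι → Prop} {x : Q} {a : V.space x} :
    a ∈ (φ.partSum P).sub x ↔ ∀ i, ¬ P i → (φ.coord i).app x a = 0 := by
  simp [Iso.partSum]

theorem Iso.single_mem_partSum (φ : Iso V (directSum W)) {P : ι → Prop} {i : ι} (hi : P i) {x : Q}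
    (a : (W i).space x) : (φ.single i).app x a ∈ (φ.partSum P).sub x :=
  φ.mem_partSum.2 fun j hj => φ.coord_single_of_ne (by rintro rfl; exact hj hi) x a

theorem Iso.partSum_mono (φ : Iso V (directSum W)) {P R : ι → Prop} (h : ∀ i, P i → R i) :
    φ.partSum P ≤ φ.partSum R :=
  fun _ _ ha => φ.mem_partSum.2 fun i hi => φ.mem_partSum.1 ha i (mt (h i) hi)

theorem Iso.partSum_eq_bot (φ : Iso V (directSum W)) {P : ι → Prop} (h : ∀ i, ¬ P i) :
    φ.partSum P = ⊥ := by
  refine Subrep.ext (funext fun x => (Submodule.eq_bot_iff _).2 fun a ha => ?_)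
  refine φ.ext_coord fun i => ?_
  rw [φ.mem_partSum.1 ha i (h i), map_zero]

theorem Iso.partSum_eq_top (φ : Iso V (directSum W)) {P : ι → Prop} (h : ∀ i, P i) :
    φ.partSum P = ⊤ :=
  Subrep.ext (funext fun _ => (Submodule.eq_top_iff').2 fun _ =>
    φ.mem_partSum.2 fun i hi => absurd (h i) hi)

-- The coordinates in `P` determine an element of the partial sum, since its other coordinates
-- vanish. The commuting square makes precise that `ψ` is the restriction of `φ`.
open Classical in
theorem Iso.exists_partSum_iso (φ : Iso V (directSum W)) (P : ι → Prop) :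
    ∃ ψ : Iso (φ.partSum P).toRep (directSum fun i : {i // P i} => W i),
      ∀ x (a : (φ.partSum P).toRep.space x),
        φ.app x ((φ.partSum P).incl.app x a) = (directSumIncl W P).app x (ψ.app x a) := by
  let f : Hom (φ.partSum P).toRep (directSum fun i : {i // P i} => W i) :=
    directSumLift fun i => (φ.coord i.1).comp (φ.partSum P).incl
  have key : ∀ x (a : (φ.partSum P).toRep.space x),
      φ.app x ((φ.partSum P).incl.app x a) = (directSumIncl W P).app x (f.app x a) := by
    intro x a
    refine directSum_ext fun i => ?_
    change (φ.coord i).app x a.1 = if h : P i then (φ.coord i).app x a.1 else 0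
    split_ifs with h
    · rfl
    · exact φ.mem_partSum.1 a.2 i h
  refine ⟨Iso.ofBijective f fun x => ⟨?_, ?_⟩, key⟩
  · intro a b hab
    have h := key x a
    rw [hab, ← key x b] at h
    exact Subtype.ext ((φ.app x).injective h)
  · intro g
    obtain ⟨a, ha⟩ := φ.exists_coord_eq x fun i => if h : P i then g ⟨i, h⟩ else 0
    refine ⟨⟨a, φ.mem_partSum.2 fun i hi => ?_⟩, ?_⟩
    · rw [ha i, dif_neg hi]
    · refine directSum_ext fun i => ?_
      exact (ha i.1).trans (dif_pos i.2)

-- The coordinates in `R` map the `P`-part onto the sum over `R`, and their common kernel there is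
-- the intersection with the `S`-part. `S` need not imply `P`.
open Classical in
theorem Iso.nonempty_partSum_quotient_iso (φ : Iso V (directSum W)) {P S R : ι → Prop}
    (hR : ∀ i, R i ↔ P i ∧ ¬ S i) :
    Nonempty (Iso ((φ.partSum P).quotient (φ.partSum S))
      (directSum fun i : {i // R i} => W i)) := by
  let g : Hom (φ.partSum P).toRep (directSum fun i : {i // R i} => W i) :=
    directSumLift fun i => (φ.coord i.1).comp (φ.partSum P).incl
  have hg : ∀ x (a : (φ.partSum P).toRep.space x),
      (φ.partSum P).incl.app x a ∈ (φ.partSum S).sub x ↔ g.app x a = 0 := by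
    intro x a
    constructor
    · intro h
      refine directSum_ext fun i => ?_
      rw [map_zero]
      exact φ.mem_partSum.1 h i.1 ((hR i.1).1 i.2).2
    · intro h
      refine φ.mem_partSum.2 fun i hi => ?_
      by_cases hP : P i
      · exact congrFun h ⟨i, (hR i).2 ⟨hP, hi⟩⟩
      · exact φ.mem_partSum.1 a.2 i hP
  refine ⟨Iso.ofBijective (Subrep.quotientLift _ _ g fun x a h => (hg x a).1 h)
    fun x => ⟨?_, ?_⟩⟩
  · rw [injective_iff_map_eq_zero]
    intro a ha
    obtain ⟨b, rfl⟩ := Subrep.quotientMk_surjective _ _ x a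
    exact (Subrep.quotientMk_eq_zero_iff b).2 ((hg x b).2 ha)
  · intro c
    obtain ⟨a, ha⟩ := φ.exists_coord_eq x fun i => if h : R i then c ⟨i, h⟩ else 0
    refine ⟨(Subrep.quotientMk _ _).app x ⟨a, φ.mem_partSum.2 fun i hi => ?_⟩, ?_⟩
    · rw [ha i, dif_neg fun h => hi ((hR i).1 h).1]
    · refine directSum_ext fun i => ?_
      exact (ha i.1).trans (dif_pos i.2)

end PartSum

end Morphisms

/-! ### Slopes, degrees and semistability. -/

section Stability

variable {K : Type u} [Field K] {Q : Type v} [Quiver Q] [Fintype Q]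

/-- The total dimension of a representation. -/
noncomputable def totalDim (V : QuiverRep.{u, v, w} K Q) : ℕ :=
  ∑ x, Module.finrank K (V.space x)

/-- The degree of a representation for the stability condition `α - σ`: its sign compares the
slope for `α` with `σ`. -/
noncomputable def weight (α : Q → ℝ) (σ : ℝ) (V : QuiverRep.{u, v, w} K Q) : ℝ :=
  ∑ x, (α x - σ) * (Module.finrank K (V.space x) : ℝ)

theorem weight_eq (α : Q → ℝ) (σ : ℝ) (V : QuiverRep.{u, v, w} K Q) :
    weight α σ V = ∑ x, α x * (Module.finrank K (V.space x) : ℝ) - σ * V.totalDim := by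
  simp [weight, totalDim, sub_mul, Finset.mul_sum]

theorem slope_eq (α : Q → ℝ) (V : QuiverRep.{u, v, w} K Q) :
    slope α V = (∑ x, α x * (Module.finrank K (V.space x) : ℝ)) / V.totalDim := by
  simp [slope, totalDim]

theorem weight_sub_weight (α : Q → ℝ) (σ τ : ℝ) (V : QuiverRep.{u, v, w} K Q) :
    weight α σ V - weight α τ V = (τ - σ) * V.totalDim := by
  rw [weight_eq, weight_eq]
  ring

theorem totalDim_pos_iff (V : QuiverRep.{u, v, w} K Q) : 0 < V.totalDim ↔ V.IsNonzero := by
  simp [totalDim, IsNonzero, Finset.sum_pos_iff, Module.finrank_pos_iff]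

theorem slope_le_iff {α : Q → ℝ} {V : QuiverRep.{u, v, w} K Q} (hV : V.IsNonzero) (σ : ℝ) :
    slope α V ≤ σ ↔ weight α σ V ≤ 0 := by
  have h : (0 : ℝ) < V.totalDim := by exact_mod_cast V.totalDim_pos_iff.2 hV
  rw [slope_eq, div_le_iff₀ h, weight_eq, sub_nonpos]

theorem slope_eq_iff {α : Q → ℝ} {V : QuiverRep.{u, v, w} K Q} (hV : V.IsNonzero) (σ : ℝ) :
    slope α V = σ ↔ weight α σ V = 0 := by
  have h : (0 : ℝ) < V.totalDim := by exact_mod_cast V.totalDim_pos_iff.2 hV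
  rw [slope_eq, div_eq_iff h.ne', weight_eq, sub_eq_zero]

/-- All subrepresentations of `V`, the zero one included, have nonpositive degree for `α - σ`. -/
def SlopesLE (α : Q → ℝ) (σ : ℝ) (V : QuiverRep.{u, v, w} K Q) : Prop :=
  ∀ U : Subrep V, weight α σ U.toRep ≤ 0

theorem weight_eq_zero_of_not_isNonzero {V : QuiverRep.{u, v, w} K Q} (h : ¬ V.IsNonzero)
    (α : Q → ℝ) (σ : ℝ) : weight α σ V = 0 := by
  refine Finset.sum_eq_zero fun x _ => ?_
  have : Subsingleton (V.space x) := not_nontrivial_iff_subsingleton.1 fun hx => h ⟨x, hx⟩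
  rw [Module.finrank_zero_of_subsingleton, Nat.cast_zero, mul_zero]

/-- Clearing the denominator turns slope inequalities into signs of the degree, which is additive
and makes sense for the zero representation. -/
theorem isSemistable_and_slope_eq_iff {α : Q → ℝ} {V : QuiverRep.{u, v, w} K Q} {σ : ℝ} :
    IsSemistable α V ∧ slope α V = σ ↔
      V.IsNonzero ∧ weight α σ V = 0 ∧ SlopesLE α σ V := by
  constructor
  · rintro ⟨⟨hV, hs⟩, rfl⟩
    refine ⟨hV, (slope_eq_iff hV _).1 rfl, fun U => ?_⟩
    by_cases hU : U = ⊥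
    · exact (weight_eq_zero_of_not_isNonzero (fun h => (U.ne_bot_iff.2 h) hU) _ _).le
    · exact (slope_le_iff (U.ne_bot_iff.1 hU) _).1 (hs U hU)
  · rintro ⟨hV, h0, hU⟩
    obtain rfl := (slope_eq_iff hV σ).2 h0
    exact ⟨⟨hV, fun U h => (slope_le_iff (U.ne_bot_iff.1 h) _).2 (hU U)⟩, rfl⟩

theorem IsSemistable.weight_eq_zero {α : Q → ℝ} {V : QuiverRep.{u, v, w} K Q}
    (h : IsSemistable α V) : weight α (slope α V) V = 0 :=
  (isSemistable_and_slope_eq_iff.1 ⟨h, rfl⟩).2.1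

theorem IsSemistable.slopesLE {α : Q → ℝ} {V : QuiverRep.{u, v, w} K Q}
    (h : IsSemistable α V) : SlopesLE α (slope α V) V :=
  (isSemistable_and_slope_eq_iff.1 ⟨h, rfl⟩).2.2

theorem weight_top (α : Q → ℝ) (σ : ℝ) (V : QuiverRep.{u, v, w} K Q) :
    weight α σ (⊤ : Subrep V).toRep = weight α σ V :=
  Finset.sum_congr rfl fun x _ =>
    congrArg (fun k : ℕ => (α x - σ) * (k : ℝ)) (finrank_top K (V.space x))

theorem finrank_map_add_finrank_inf_ker {E : Type w} {E' : Type w'} [AddCommGroup E] [Module K E]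
    [FiniteDimensional K E] [AddCommGroup E'] [Module K E'] (g : E →ₗ[K] E')
    (S : Submodule K E) :
    Module.finrank K (S.map g) + Module.finrank K (S ⊓ LinearMap.ker g : Submodule K E) =
      Module.finrank K S := by
  have h := (g.domRestrict S).finrank_range_add_finrank_ker
  rw [LinearMap.range_domRestrict, LinearMap.ker_domRestrict] at h
  rw [← h, ← Submodule.map_comap_subtype,
    LinearEquiv.finrank_eq (Submodule.equivMapOfInjective S.subtype S.injective_subtype _).symm]

/-- Rank-nullity at each vertex: the degree is additive on `0 → U ∩ ker f → U → f(U) → 0`. -/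
theorem weight_map_add_weight_infKer {V : QuiverRep.{u, v, w} K Q} {W : QuiverRep.{u, v, w'} K Q}
    (α : Q → ℝ) (σ : ℝ) (f : Hom V W) (U : Subrep V) :
    weight α σ (U.map f).toRep + weight α σ (U.infKer f).toRep = weight α σ U.toRep := by
  rw [weight, weight, weight, ← Finset.sum_add_distrib]
  refine Finset.sum_congr rfl fun x _ => ?_
  rw [← mul_add]
  congr 1
  exact_mod_cast finrank_map_add_finrank_inf_ker (f.app x) (U.sub x)

theorem weight_congr {V : QuiverRep.{u, v, w} K Q} {W : QuiverRep.{u, v, w'} K Q} (φ : Iso V W)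
    (α : Q → ℝ) (σ : ℝ) : weight α σ V = weight α σ W :=
  Finset.sum_congr rfl fun x _ => by rw [LinearEquiv.finrank_eq (φ.app x)]

theorem SlopesLE.congr {V : QuiverRep.{u, v, w} K Q} {W : QuiverRep.{u, v, w'} K Q} (φ : Iso V W)
    {α : Q → ℝ} {σ : ℝ} (h : SlopesLE α σ W) : SlopesLE α σ V := by
  intro U
  refine le_trans (le_of_eq ?_) (h (U.map φ.toHom))
  refine Finset.sum_congr rfl fun x _ => ?_
  exact congrArg (fun k : ℕ => (α x - σ) * (k : ℝ))
    (LinearEquiv.finrank_map_eq (φ.app x) (U.sub x)).symm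

/-- There are no nonzero morphisms from a semistable representation to one of smaller slope. -/
theorem Hom.app_eq_zero_of_lt {V : QuiverRep.{u, v, w} K Q} {W : QuiverRep.{u, v, w'} K Q}
    {α : Q → ℝ} {σ τ : ℝ} (hV : weight α σ V = 0) (hV' : SlopesLE α σ V) (hW : SlopesLE α τ W)
    (h : τ < σ) (f : Hom V W) (x : Q) (a : V.space x) : f.app x a = 0 := by
  have h1 := weight_map_add_weight_infKer α σ f ⊤
  rw [weight_top, hV] at h1
  have h2 := hV' ((⊤ : Subrep V).infKer f)
  have h3 := hW ((⊤ : Subrep V).map f)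
  have h4 := weight_sub_weight α τ σ ((⊤ : Subrep V).map f).toRep
  by_contra hne
  have hpos : (0 : ℝ) < ((⊤ : Subrep V).map f).toRep.totalDim := by
    refine Nat.cast_pos.2 ((totalDim_pos_iff _).2 ⟨x, ?_⟩)
    exact ⟨⟨f.app x a, a, trivial, rfl⟩, 0, fun h => hne (congrArg Subtype.val h)⟩
  -- The image has degree `≥ 0` for `σ`, because the kernel has degree `≤ 0`, and degree `≤ 0` for
  -- `τ`. As `τ < σ`, a nonzero image would have strictly larger degree for `τ` than for `σ`.
  nlinarith [mul_pos (sub_pos.2 h) hpos]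

/-- Summands are peeled off one at a time: projecting `U` to `W i` leaves an image inside `W i` and
a kernel supported on the remaining indices. -/
theorem SlopesLE.directSum {ι : Type} [Finite ι] {W : ι → QuiverRep.{u, v, w} K Q} {α : Q → ℝ}
    {σ : ℝ} (h : ∀ i, SlopesLE α σ (W i)) : SlopesLE α σ (directSum W) := by
  classical
  have := Fintype.ofFinite ι
  suffices H : ∀ (s : Finset ι) (U : Subrep (QuiverRep.directSum W)),
      (∀ x, ∀ a ∈ U.sub x, ∀ i ∉ s, (directSumProj W i).app x a = 0) →
        weight α σ U.toRep ≤ 0 from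
    fun U => H Finset.univ U fun _ _ _ i hi => absurd (Finset.mem_univ i) hi
  intro s
  induction s using Finset.induction_on with
  | empty =>
    intro U hU
    refine (weight_eq_zero_of_not_isNonzero ?_ _ _).le
    rintro ⟨x, a, b, hab⟩
    refine hab (Subtype.ext (directSum_ext fun i => ?_))
    rw [hU x _ a.2 i (Finset.notMem_empty i), hU x _ b.2 i (Finset.notMem_empty i)]
  | insert i s _ ih =>
    intro U hU
    rw [← weight_map_add_weight_infKer α σ (directSumProj W i) U]
    refine add_nonpos (h i _) (ih _ fun x a ha j hj => ?_)
    by_cases hji : j = i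
    · subst hji
      exact ha.2
    · exact hU x a ha.1 j (by simp [hji, hj])

theorem weight_directSum {ι : Type} [Fintype ι] (W : ι → QuiverRep.{u, v, w} K Q) (α : Q → ℝ)
    (σ : ℝ) : weight α σ (directSum W) = ∑ i, weight α σ (W i) := by
  simp only [weight]
  rw [Finset.sum_comm]
  refine Finset.sum_congr rfl fun x _ => ?_
  rw [← Finset.mul_sum, ← Nat.cast_sum]
  exact congrArg (fun k : ℕ => (α x - σ) * (k : ℝ))
    (Module.finrank_pi_fintype K (M := fun i => (W i).space x))

end Stability

/-! ### Harder–Narasimhan filtrations of sums of semistable representations. -/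

section HarderNarasimhan

variable {K : Type u} [Field K] {Q : Type v} [Quiver Q] [Fintype Q] {α : Q → ℝ}
  {ι : Type} [Finite ι] {W : ι → QuiverRep.{u, v, w'} K Q} {V : QuiverRep.{u, v, w} K Q}

theorem IsSemistable.hom_app_eq_zero {A : QuiverRep.{u, v, w} K Q} {B : QuiverRep.{u, v, w'} K Q}
    (hA : IsSemistable α A) (hB : IsSemistable α B) (h : slope α B < slope α A) (f : Hom A B)
    (x : Q) (a : A.space x) : f.app x a = 0 :=
  f.app_eq_zero_of_lt hA.weight_eq_zero hA.slopesLE hB.slopesLE h x a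

/-- If an upper set `S` of slopes separates the quotients of an HN filtration below the `k`-th
term from those above, then the `k`-th term consists of the summands with slope in `S`. -/
theorem HNFiltration.step_eq_partSum (φ : Iso V (directSum W)) (hW : ∀ i, IsSemistable α (W i))
    (F : HNFiltration α V) (k : Fin (F.length + 1)) {S : Set ℝ} (hS : IsUpperSet S)
    (hlt : ∀ j : Fin F.length, (j : ℕ) < k → slope α (F.quot j) ∈ S)
    (hge : ∀ j : Fin F.length, (k : ℕ) ≤ j → slope α (F.quot j) ∉ S) :
    F.step k = φ.partSum fun i => slope α (W i) ∈ S := by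
  have hlt_of : ∀ a b : ℝ, a ∈ S → b ∉ S → b < a := fun a b ha hb =>
    lt_of_not_ge fun h => hb (hS h ha)
  apply le_antisymm
  -- Upwards from `0`: a coordinate with slope outside `S` kills the previous term by induction, so
  -- it factors through a semistable quotient of larger slope and vanishes.
  · have H : ∀ l : Fin (F.length + 1), l ≤ k →
        F.step l ≤ φ.partSum fun i => slope α (W i) ∈ S := by
      intro l
      induction l using Fin.induction with
      | zero =>
        intro _ x a ha
        rw [F.step_zero] at ha
        rw [(Submodule.mem_bot K).1 ha]
        exact Submodule.zero_mem _
      | succ j ih =>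
        intro hj x a ha
        have hjk : (j : ℕ) < k := hj
        refine φ.mem_partSum.2 fun i hi => ?_
        have hf : ∀ x (a : (F.step j.succ).toRep.space x),
            (F.step j.succ).incl.app x a ∈ (F.step j.castSucc).sub x →
              ((φ.coord i).comp (F.step j.succ).incl).app x a = 0 := fun x a h =>
          φ.mem_partSum.1 (ih (Fin.le_def.2 hjk.le) x h) i hi
        exact (F.semistable j).hom_app_eq_zero (hW i) (hlt_of _ _ (hlt j hjk) hi)
          (Subrep.quotientLift _ _ _ hf) x ((Subrep.quotientMk _ _).app x ⟨a, ha⟩)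
    exact H k le_rfl
  -- Downwards from `V`: a summand with slope in `S` lies in the next term by induction, and its map
  -- to the quotient of smaller slope vanishes, so it lies in this term.
  · have H : ∀ l : Fin (F.length + 1), k ≤ l →
        (φ.partSum fun i => slope α (W i) ∈ S) ≤ F.step l := by
      intro l
      induction l using Fin.reverseInduction with
      | last =>
        intro _ x a _
        rw [F.step_last]
        trivial
      | cast j ih =>
        intro hj x a ha
        have hjk : (k : ℕ) ≤ j := hj
        refine φ.mem_of_single _ a fun i => ?_
        by_cases hi : slope α (W i) ∈ S
        · let f := Subrep.codRestrict (F.step j.succ) (φ.single i) fun x b =>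
            ih (Fin.le_def.2 (hjk.trans (Nat.le_succ _))) x (φ.single_mem_partSum hi b)
          exact (Subrep.quotientMk_eq_zero_iff (f.app x _)).1
            ((hW i).hom_app_eq_zero (F.semistable j) (hlt_of _ _ hi (hge j hjk))
              ((Subrep.quotientMk _ _).comp f) x _)
        · rw [φ.mem_partSum.1 ha i hi, map_zero]
          exact Submodule.zero_mem _
    exact H k le_rfl

theorem HNFiltration.real_eq_partSum (φ : Iso V (directSum W)) (hW : ∀ i, IsSemistable α (W i))
    (F : HNFiltration α V) (t : ℝ) :
    F.real t = φ.partSum fun i => t ≤ slope α (W i) := by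
  classical
  refine F.step_eq_partSum φ hW _ (isUpperSet_Ici t) (fun j hj => ?_) fun j hj => ?_
  · have h := Nat.find_min (F.exists_index t) hj
    push Not at h
    exact h.2
  · have h := Nat.find_spec (F.exists_index t)
    have hj' : F.index t ≤ (j : ℕ) := hj
    have hlt : F.index t < F.length := hj'.trans_lt j.2
    refine not_le.2 (lt_of_le_of_lt ?_ (h hlt))
    exact F.slope_strictAnti.antitone (Fin.le_def.2 hj')

/-- With `s` the slope of the quotient, the two consecutive terms are cut out by `[s, ∞)` and `(s,
∞)`, which differ by `{s}`. -/
theorem HNFiltration.nonempty_quot_iso (φ : Iso V (directSum W))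
    (hW : ∀ i, IsSemistable α (W i)) (F : HNFiltration α V) (j : Fin F.length) :
    Nonempty (Iso (F.quot j)
      (QuiverRep.directSum fun i : {i // slope α (W i) = slope α (F.quot j)} => W i)) := by
  have h1 : F.step j.succ = φ.partSum fun i => slope α (W i) ∈ Set.Ici (slope α (F.quot j)) :=
    F.step_eq_partSum φ hW _ (isUpperSet_Ici _)
      (fun i hi => F.slope_strictAnti.antitone (Fin.le_def.2 (Nat.lt_succ_iff.1 hi)))
      fun i hi => not_le.2 (F.slope_strictAnti (Fin.lt_def.2 hi))
  have h2 : F.step j.castSucc =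
      φ.partSum fun i => slope α (W i) ∈ Set.Ioi (slope α (F.quot j)) :=
    F.step_eq_partSum φ hW _ (isUpperSet_Ioi _)
      (fun i hi => F.slope_strictAnti (Fin.lt_def.2 hi))
      fun i hi => not_lt.2 (F.slope_strictAnti.antitone (Fin.le_def.2 hi))
  have h3 : F.quot j = (F.step j.succ).quotient (F.step j.castSucc) := rfl
  -- The slope itself mentions the quotient, so it is fixed before the terms are rewritten.
  generalize slope α (F.quot j) = σ at *
  rw [h3, h1, h2]
  refine φ.nonempty_partSum_quotient_iso fun i => ?_
  rw [Set.mem_Ici, Set.mem_Ioi, not_lt, le_antisymm_iff, and_comm]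

/-- A direct sum of semistable representations has an HN filtration. -/
theorem nonempty_hnFiltration_of_iso (φ : Iso V (directSum W)) (hW : ∀ i, IsSemistable α (W i)) :
    Nonempty (HNFiltration α V) := by
  classical
  have := Fintype.ofFinite ι
  let vals : Finset ℝ := Finset.univ.image fun i => slope α (W i)
  let e := vals.orderIsoOfFin rfl
  -- The distinct slopes in decreasing order; `P k` below selects the summands whose slope is among
  -- the `k` largest.
  let σ : Fin vals.card → ℝ := fun j => e j.rev
  have hσ : StrictAnti σ := fun i j h => e.strictMono (Fin.rev_lt_rev.2 h)
  have hσ_surj : ∀ i, ∃ j, slope α (W i) = σ j := fun i =>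
    ⟨(e.symm ⟨_, Finset.mem_image_of_mem _ (Finset.mem_univ i)⟩).rev, by simp [σ]⟩
  have hσ_mem : ∀ j, ∃ i, slope α (W i) = σ j := fun j => by
    obtain ⟨i, -, hi⟩ := Finset.mem_image.1 (e j.rev).2
    exact ⟨i, hi⟩
  let P : Fin (vals.card + 1) → ι → Prop := fun k i =>
    ∃ j : Fin vals.card, j.castSucc < k ∧ slope α (W i) = σ j
  have hquot : ∀ j : Fin vals.card,
      IsSemistable α ((φ.partSum (P j.succ)).quotient (φ.partSum (P j.castSucc))) ∧
        slope α ((φ.partSum (P j.succ)).quotient (φ.partSum (P j.castSucc))) = σ j := by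
    intro j
    obtain ⟨ψ⟩ := φ.nonempty_partSum_quotient_iso (P := P j.succ) (S := P j.castSucc)
      (R := fun i => slope α (W i) = σ j) fun i => by
        constructor
        · intro h
          refine ⟨⟨j, Fin.castSucc_lt_succ, h⟩, ?_⟩
          rintro ⟨k, hk, h'⟩
          exact (Fin.castSucc_lt_castSucc_iff.1 hk).ne (hσ.injective (h'.symm.trans h))
        · rintro ⟨⟨k, hk, h⟩, hn⟩
          have hkj : k ≤ j := Fin.castSucc_lt_succ_iff.1 hk
          rcases hkj.eq_or_lt with rfl | hlt
          · exact h
          · exact absurd ⟨k, Fin.castSucc_lt_castSucc_iff.2 hlt, h⟩ hn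
    have hR : ∀ i : {i // slope α (W i) = σ j}, _ := fun i =>
      isSemistable_and_slope_eq_iff.1 ⟨hW i.1, i.2⟩
    refine isSemistable_and_slope_eq_iff.2 ⟨?_, ?_, ?_⟩
    · obtain ⟨i, hi⟩ := hσ_mem j
      obtain ⟨x, hx⟩ := (hW i).1
      obtain ⟨a, ha⟩ := exists_ne (0 : (W i).space x)
      refine ⟨x, (ψ.app x).symm ((directSumSingle _ ⟨i, hi⟩).app x a), 0, fun h => ha ?_⟩
      rw [LinearEquiv.symm_apply_eq, map_zero] at h
      rw [← directSumProj_single_self (W := fun i : {i // slope α (W i) = σ j} => W i)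
        ⟨i, hi⟩ x a, h, map_zero]
    · rw [weight_congr ψ, weight_directSum]
      exact Finset.sum_eq_zero fun i _ => (hR i).2.1
    · exact (SlopesLE.directSum fun i => (hR i).2.2).congr ψ
  refine ⟨{
    length := vals.card
    step := fun k => φ.partSum (P k)
    step_zero := φ.partSum_eq_bot ?_
    step_last := φ.partSum_eq_top ?_
    strictMono := ?_
    semistable := fun j => (hquot j).1
    slope_strictAnti := ?_ }⟩
  · rintro i ⟨j, hj, -⟩
    exact absurd hj (Fin.not_lt_zero _)
  · intro i
    obtain ⟨j, hj⟩ := hσ_surj i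
    exact ⟨j, Fin.castSucc_lt_last j, hj⟩
  · refine Fin.strictMono_iff_lt_succ.2 fun j => lt_of_le_not_ge ?_ fun h => ?_
    · exact φ.partSum_mono fun i ⟨k, hk, hi⟩ => ⟨k, hk.trans Fin.castSucc_lt_succ, hi⟩
    -- If two consecutive terms agreed, their quotient would be zero and not semistable.
    · obtain ⟨x, a, b, hab⟩ := (hquot j).1.1
      obtain ⟨a, rfl⟩ := Subrep.quotientMk_surjective _ _ x a
      obtain ⟨b, rfl⟩ := Subrep.quotientMk_surjective _ _ x b
      refine hab ?_
      rw [(Subrep.quotientMk_eq_zero_iff a).2 (h x a.2),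
        (Subrep.quotientMk_eq_zero_iff b).2 (h x b.2)]
  · intro i j hij
    simp only [(hquot _).2]
    exact hσ hij

end HarderNarasimhan

/-! ### Splitting off retracts. -/

section Splitting

variable {K : Type u} [Field K] {Q : Type v} [Quiver Q]

theorem nonempty_iso_directSum_reindex {ι κ : Type} [Finite ι] [Finite κ]
    {V : QuiverRep.{u, v, w} K Q} {W : ι → QuiverRep.{u, v, w'} K Q}
    {W' : κ → QuiverRep.{u, v, w'} K Q} (e : κ ≃ ι) (h : ∀ k, W (e k) = W' k)
    (φ : Iso V (directSum W)) : Nonempty (Iso V (directSum W')) := by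
  obtain rfl : (fun k => W (e k)) = W' := funext h
  refine ⟨Iso.ofBijective (directSumLift fun k => φ.coord (e k)) fun x => ⟨?_, ?_⟩⟩
  · intro a b hab
    refine φ.ext_coord fun i => ?_
    obtain ⟨k, rfl⟩ := e.surjective i
    exact congrFun hab k
  · intro f
    obtain ⟨a, ha⟩ := φ.exists_coord_eq x (Equiv.piCongrLeft (fun i => (W i).space x) e f)
    refine ⟨a, funext fun k => (ha (e k)).trans ?_⟩
    exact Equiv.piCongrLeft_apply_apply (fun i => (W i).space x) e f k

/-- A retract `W none` of `V` splits off as a direct summand. -/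
theorem nonempty_iso_directSum_option {ι : Type} [Finite ι] {V : QuiverRep.{u, v, w} K Q}
    {W : Option ι → QuiverRep.{u, v, w'} K Q} (p : Hom V (W none)) (s : Hom (W none) V)
    (hps : ∀ x a, p.app x (s.app x a) = a)
    (φ : Iso ((⊤ : Subrep V).infKer p).toRep (directSum fun i => W (some i))) :
    Nonempty (Iso V (directSum W)) := by
  -- `id - s ∘ p` is the projection onto `ker p` along the image of `s`.
  let q : Hom V V :=
    { app := fun x => LinearMap.id - s.app x ∘ₗ p.app x
      naturality := fun e a => by simp [p.naturality, s.naturality] }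
  have hq : ∀ x a, q.app x a = a - s.app x (p.app x a) := fun _ _ => rfl
  let r : Hom V ((⊤ : Subrep V).infKer p).toRep := Subrep.codRestrict _ q fun x a => by
    refine ⟨trivial, ?_⟩
    change p.app x (q.app x a) = 0
    rw [hq, map_sub, hps, sub_self]
  have hr : ∀ x a, ((r.app x a).1 : V.space x) = a - s.app x (p.app x a) := fun _ _ => rfl
  let f : ∀ o, Hom V (W o)
    | none => p
    | some i => (φ.coord i).comp r
  refine ⟨Iso.ofBijective (directSumLift f) fun x => ⟨?_, ?_⟩⟩
  · rw [injective_iff_map_eq_zero]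
    intro a ha
    have h0 : p.app x a = 0 := congrFun ha none
    have h1 : r.app x a = 0 := φ.ext_coord fun i => by
      rw [map_zero]
      exact congrFun ha (some i)
    have h2 := hr x a
    rw [h1, h0, map_zero, sub_zero] at h2
    exact h2.symm
  · intro g
    obtain ⟨b, hb⟩ := φ.exists_coord_eq x fun i => g (some i)
    have hpb : p.app x b.1 = 0 := b.2.2
    have hp : p.app x (b.1 + s.app x (g none)) = g none := by
      rw [map_add, hpb, hps, zero_add]
    have hrb : r.app x (b.1 + s.app x (g none)) = b := Subtype.ext <| by
      rw [hr, hp, add_sub_cancel_right]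
    refine ⟨b.1 + s.app x (g none), funext fun o => ?_⟩
    cases o with
    | none => exact hp
    | some i => exact (congrArg ((φ.coord i).app x) hrb).trans (hb i)

theorem totalDim_infKer_lt [Fintype Q] {V : QuiverRep.{u, v, w} K Q} {W : QuiverRep.{u, v, w'} K Q}
    (p : Hom V W) {x : Q} {a : V.space x} (ha : p.app x a ≠ 0) :
    ((⊤ : Subrep V).infKer p).toRep.totalDim < V.totalDim := by
  refine Finset.sum_lt_sum (fun y _ => Submodule.finrank_le _) ⟨x, Finset.mem_univ x, ?_⟩
  refine Submodule.finrank_lt fun h => ha ?_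
  have : a ∈ ((⊤ : Subrep V).infKer p).sub x := by rw [h]; trivial
  exact this.2

end Splitting

/-! ### Semistability of interval modules. -/

section Interval

variable {K : Type u} [Field K] {n : ℕ}

/-- The number of a vertex. -/
abbrev _root_.EquiorientedA.val (i : EquiorientedA n) : ℕ := Fin.val (n := n) i

/-- The vertex with a given number. -/
def _root_.EquiorientedA.ofFin (i : Fin n) : EquiorientedA n := i

theorem _root_.EquiorientedA.val_lt (i : EquiorientedA n) : i.val < n := Fin.is_lt (n := n) i

theorem inside_iff {I : NonemptyInterval (Fin n)} {i : EquiorientedA n} :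
    Inside I i ↔ (I.fst : ℕ) ≤ i.val ∧ i.val ≤ (I.snd : ℕ) := Iff.rfl

theorem _root_.EquiorientedA.val_add_one {i j : EquiorientedA n} (e : i ⟶ j) :
    i.val + 1 = j.val := e.down

theorem intervalModule_subsingleton {I : NonemptyInterval (Fin n)} {i : EquiorientedA n}
    (h : ¬ Inside I i) : Subsingleton ((intervalModule K I).space i) :=
  ⟨fun _ _ => funext fun p => absurd p.down h⟩

theorem intervalModule_ext {I : NonemptyInterval (Fin n)} {i : EquiorientedA n}
    {a b : (intervalModule K I).space i} (h : ∀ hi : Inside I i, a ⟨hi⟩ = b ⟨hi⟩) : a = b :=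
  funext fun p => h p.down

theorem intervalModule_map_apply {I : NonemptyInterval (Fin n)} {i j : EquiorientedA n}
    (e : i ⟶ j) (a : (intervalModule K I).space i) (hi : Inside I i) (hj : Inside I j) :
    (intervalModule K I).map e a ⟨hj⟩ = a ⟨hi⟩ := by
  simp only [intervalModule, dif_pos hi]
  rfl

theorem intervalModule_map_eq_zero {I : NonemptyInterval (Fin n)} {i j : EquiorientedA n}
    (e : i ⟶ j) (a : (intervalModule K I).space i) (hi : ¬ Inside I i) :
    (intervalModule K I).map e a = 0 := by
  have := intervalModule_subsingleton (K := K) hi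
  rw [Subsingleton.elim a 0, map_zero]

open Classical in
theorem finrank_intervalModule (I : NonemptyInterval (Fin n)) (i : EquiorientedA n) :
    Module.finrank K ((intervalModule K I).space i) = if Inside I i then 1 else 0 := by
  change Module.finrank K (PLift (Inside I i) → K) = _
  rw [Module.finrank_fintype_fun_eq_card]
  split_ifs with h
  · exact Fintype.card_eq_one_iff.2 ⟨⟨h⟩, fun _ => rfl⟩
  · exact Fintype.card_eq_zero_iff.2 ⟨fun p => h p.down⟩

theorem intervalModule_isNonzero (I : NonemptyInterval (Fin n)) :
    (intervalModule K I).IsNonzero := by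
  have h : Inside I (EquiorientedA.ofFin I.fst) := inside_iff.2 ⟨le_rfl, I.fst_le_snd⟩
  exact ⟨EquiorientedA.ofFin I.fst, fun _ => 1, fun _ => 0, fun h' => one_ne_zero (congrFun h' ⟨h⟩)⟩

/-- A nonzero subrepresentation of `I[u, v]` has the dimension vector of some `I[w, v]` with
`u ≤ w`. -/
theorem exists_finrank_eq_of_subrep_intervalModule {I : NonemptyInterval (Fin n)}
    (U : Subrep (intervalModule K I)) (hU : U ≠ ⊥) :
    ∃ J : NonemptyInterval (Fin n), I.fst ≤ J.fst ∧ J.snd = I.snd ∧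
      ∀ x, Module.finrank K (U.sub x) = Module.finrank K ((intervalModule K J).space x) := by
  classical
  let S : Finset (EquiorientedA n) := Finset.univ.filter fun x => U.sub x ≠ ⊥
  have hS : ∀ x, x ∈ S ↔ U.sub x ≠ ⊥ := fun x => by simp [S]
  have hin : ∀ x : EquiorientedA n, U.sub x ≠ ⊥ → Inside I x := by
    intro x hx
    by_contra h
    have := intervalModule_subsingleton (K := K) h
    exact hx (Subsingleton.elim _ _)
  have hne : S.Nonempty := by
    by_contra h
    refine hU (Subrep.ext (funext fun x => ?_))
    by_contra hx
    exact h ⟨x, (hS x).2 hx⟩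
  -- From the leftmost vertex `b` where `U` is nonzero, the identity maps carry a nonzero element on
  -- to every vertex up to `v`. Hence `J = [b, v]`.
  obtain ⟨b, hbS, hmin⟩ := S.exists_min_image EquiorientedA.val hne
  have hb := (hS b).1 hbS
  obtain ⟨hb1, hb2⟩ := hin b hb
  have hstep : ∀ (d : ℕ) (x : EquiorientedA n), b.val + d = x.val → x.val ≤ (I.snd : ℕ) →
      U.sub x ≠ ⊥ := by
    intro d
    induction d with
    | zero =>
      intro x hx _
      obtain rfl : b = x := Fin.ext hx
      exact hb
    | succ d ih =>
      intro x hx hxI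
      let y : EquiorientedA n := EquiorientedA.ofFin ⟨b.val + d, by have := x.val_lt; omega⟩
      have hy : b.val + d = y.val := rfl
      obtain ⟨a, ha, ha0⟩ := Submodule.exists_mem_ne_zero_of_ne_bot (ih y hy (by omega))
      let e : y ⟶ x := ⟨hx⟩
      have hbI : (I.fst : ℕ) ≤ b.val := hb1
      have hxi : Inside I x := inside_iff.2 ⟨by omega, hxI⟩
      refine (Submodule.ne_bot_iff _).2 ⟨_, U.map_mem e a ha, fun h => ha0 ?_⟩
      refine intervalModule_ext fun hi => ?_
      rw [← intervalModule_map_apply e a hi hxi, h]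
      rfl
  refine ⟨⟨(b, I.snd), hb2⟩, hb1, rfl, fun x => ?_⟩
  rw [finrank_intervalModule]
  split_ifs with h
  · have h' := inside_iff.1 h
    have hne' := hstep _ x (Nat.add_sub_of_le h'.1) h.2
    have h1 := Submodule.finrank_le (U.sub x)
    rw [finrank_intervalModule, if_pos (hin x hne')] at h1
    have h2 := Submodule.one_le_finrank_iff.2 hne'
    exact le_antisymm h1 h2
  · rw [Submodule.finrank_eq_zero]
    by_contra hx
    exact h ⟨hmin x ((hS x).2 hx), (hin x hx).2⟩

/-- Subrepresentations keep the right end and can only move the left end to the right, hence are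
never earlier in the lexicographic order. This is where antitonicity enters. -/
theorem isSemistable_intervalModule {α : EquiorientedA n → ℝ} (hα : IsAntitoneSlope K α)
    (I : NonemptyInterval (Fin n)) : IsSemistable α (intervalModule K I) := by
  refine ⟨intervalModule_isNonzero I, fun U hU => ?_⟩
  obtain ⟨J, h1, h2, h3⟩ := exists_finrank_eq_of_subrep_intervalModule U hU
  have h : slope α U.toRep = slope α (intervalModule K J) := by
    have h3' : ∀ x, Module.finrank K (U.toRep.space x) = _ := h3
    simp only [slope, h3']
  rw [h]
  refine hα I J ?_
  rcases h1.lt_or_eq with h1 | h1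
  · exact Or.inl h1
  · exact Or.inr ⟨h1, h2.ge⟩

end Interval

/-! ### Existence of barcode decompositions. -/

section Barcode

variable {K : Type u} [Field K] {n : ℕ}

/-- The composite of the maps along the `d` edges from `x_i` to `x_(i+d)`. -/
def pathMapOfLength (V : QuiverRep.{u, 0, w} K (EquiorientedA n)) (i : EquiorientedA n) :
    ∀ (d : ℕ) (j : EquiorientedA n), i.val + d = j.val → (V.space i →ₗ[K] V.space j)
  | 0, _, h => (Fin.ext h : i = _) ▸ LinearMap.id
  | d + 1, j, h =>
    V.map (x := EquiorientedA.ofFin ⟨i.val + d, by have := j.val_lt; omega⟩) (y := j) ⟨h⟩ ∘ₗ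
      pathMapOfLength V i d (EquiorientedA.ofFin ⟨i.val + d, by have := j.val_lt; omega⟩) rfl

/-- The composite of the maps along the edges from `x_i` to `x_j`, for `i ≤ j`. -/
def pathMap (V : QuiverRep.{u, 0, w} K (EquiorientedA n)) {i j : EquiorientedA n}
    (h : i.val ≤ j.val) : V.space i →ₗ[K] V.space j :=
  V.pathMapOfLength i (j.val - i.val) j (Nat.add_sub_of_le h)

variable (V : QuiverRep.{u, 0, w} K (EquiorientedA n))

theorem pathMap_self {i : EquiorientedA n} (a : V.space i) : V.pathMap le_rfl a = a := by
  have : ∀ d (h : i.val + d = i.val), V.pathMapOfLength i d i h a = a := by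
    intro d h
    obtain rfl : d = 0 := by omega
    rfl
  exact this _ _

theorem pathMap_edge {i j k : EquiorientedA n} (h : i.val ≤ j.val) (e : j ⟶ k)
    (h' : i.val ≤ k.val) (a : V.space i) : V.pathMap h' a = V.map e (V.pathMap h a) := by
  -- The lengths are made free variables so that `d' = d + 1` can be substituted; the differences of
  -- vertex numbers do not reduce.
  have : ∀ d d' (h : i.val + d = j.val) (h' : i.val + d' = k.val),
      V.pathMapOfLength i d' k h' a = V.map e (V.pathMapOfLength i d j h a) := by
    intro d d' h h'
    have he := EquiorientedA.val_add_one e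
    obtain rfl : d' = d + 1 := by omega
    have hlt : i.val + d < n := by have := k.val_lt; clear h he; omega
    obtain rfl : j = EquiorientedA.ofFin ⟨i.val + d, hlt⟩ :=
      Fin.ext h.symm
    rfl
  exact this _ _ _ _

theorem pathMap_pathMap {i j k : EquiorientedA n} (h : i.val ≤ j.val) (h' : j.val ≤ k.val)
    (a : V.space i) : V.pathMap h' (V.pathMap h a) = V.pathMap (h.trans h') a := by
  obtain ⟨d, hd⟩ := Nat.exists_eq_add_of_le h'
  induction d generalizing k with
  | zero =>
    obtain rfl : j = k := Fin.ext hd.symm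
    rw [pathMap_self]
  | succ d ih =>
    let l : EquiorientedA n := EquiorientedA.ofFin ⟨j.val + d, by have := k.val_lt; omega⟩
    let e : l ⟶ k := ⟨hd.symm⟩
    have hjl : j.val ≤ l.val := Nat.le_add_right _ _
    rw [V.pathMap_edge hjl e, ih hjl rfl, ← V.pathMap_edge (h.trans hjl) e]

theorem edge_pathMap {i j k : EquiorientedA n} (e : i ⟶ j) (h : j.val ≤ k.val)
    (h' : i.val ≤ k.val) (a : V.space i) : V.pathMap h (V.map e a) = V.pathMap h' a := by
  have hij : i.val ≤ j.val := by have := EquiorientedA.val_add_one e; omega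
  rw [← V.pathMap_pathMap hij h, V.pathMap_edge le_rfl e, pathMap_self]

open Classical in
/-- An element at `x_u` whose image at `x_(v+1)` is zero gives a morphism from `I[u, v]`. -/
theorem exists_hom_from_intervalModule (I : NonemptyInterval (Fin n))
    (a : V.space (EquiorientedA.ofFin I.fst))
    (ha : ∀ (y : EquiorientedA n) (h : (I.fst : ℕ) ≤ y.val), (I.snd : ℕ) + 1 = y.val →
      V.pathMap (i := EquiorientedA.ofFin I.fst) h a = 0) :
    ∃ s : Hom (intervalModule K I) V, ∀ x (h : Inside I x) (f : (intervalModule K I).space x),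
      s.app x f = f ⟨h⟩ • V.pathMap (i := EquiorientedA.ofFin I.fst) h.1 a := by
  let g : ∀ x, (intervalModule K I).space x →ₗ[K] V.space x := fun x =>
    if h : Inside I x then
      LinearMap.toSpanSingleton K _ (V.pathMap (i := EquiorientedA.ofFin I.fst) h.1 a) ∘ₗ
        (LinearMap.proj (PLift.up h) : (PLift (Inside I x) → K) →ₗ[K] K)
    else 0
  have hg : ∀ x (h : Inside I x) f,
      g x f = f ⟨h⟩ • V.pathMap (i := EquiorientedA.ofFin I.fst) h.1 a := by
    intro x h f
    simp only [g, dif_pos h]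
    rfl
  refine ⟨⟨g, fun {x y} e f => ?_⟩, hg⟩
  by_cases hx : Inside I x
  · have he := EquiorientedA.val_add_one e
    have hx' := inside_iff.1 hx
    rw [hg x hx, map_smul, ← V.pathMap_edge (i := EquiorientedA.ofFin I.fst) hx.1 e
      (by change (I.fst : ℕ) ≤ _; omega)]
    by_cases hy : Inside I y
    · rw [hg y hy, intervalModule_map_apply e f hx hy]
    · have hy' := mt inside_iff.2 hy
      have := intervalModule_subsingleton (K := K) hy
      -- The edge leaves the interval, so `y` is `x_(v+1)`, where the image of `a` vanishes.
      rw [Subsingleton.elim ((intervalModule K I).map e f) 0, map_zero, ha y (by omega) (by omega),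
        smul_zero]
  · have := intervalModule_subsingleton (K := K) hx
    rw [Subsingleton.elim f 0, map_zero, map_zero, map_zero, map_zero]

/-- If `V` vanishes before `x_u`, a linear form at `x_v` gives a morphism to `I[u, v]`. -/
theorem exists_hom_to_intervalModule (I : NonemptyInterval (Fin n))
    (hV : ∀ x : EquiorientedA n, x.val < (I.fst : ℕ) → Subsingleton (V.space x))
    (l : V.space (EquiorientedA.ofFin I.snd) →ₗ[K] K) :
    ∃ p : Hom V (intervalModule K I), ∀ x (h : Inside I x) (a : V.space x),
      p.app x a ⟨h⟩ = l (V.pathMap (j := EquiorientedA.ofFin I.snd) h.2 a) := by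
  let g : ∀ x, V.space x →ₗ[K] (intervalModule K I).space x := fun x =>
    (LinearMap.pi fun h => l ∘ₗ V.pathMap (j := EquiorientedA.ofFin I.snd) h.down.2 :
      V.space x →ₗ[K] (PLift (Inside I x) → K))
  refine ⟨⟨g, fun {x y} e a => ?_⟩, fun _ _ _ => rfl⟩
  by_cases hx : Inside I x
  · refine intervalModule_ext fun hy => ?_
    rw [intervalModule_map_apply e _ hx hy]
    exact congrArg l (V.edge_pathMap e hy.2 hx.2 a)
  · rw [intervalModule_map_eq_zero e _ hx]
    refine intervalModule_ext fun hy => ?_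
    have he := EquiorientedA.val_add_one e
    have hy' := inside_iff.1 hy
    have hx' := mt inside_iff.2 hx
    -- An edge entering the interval from outside starts at `x_(u-1)`, where `V` is zero.
    have := hV x (by omega)
    rw [Subsingleton.elim a 0, map_zero, map_zero]

/-- Every nonzero representation of the equioriented quiver of type `A_n` has an interval module
as a retract. -/
theorem exists_intervalModule_retract (hV : V.IsNonzero) :
    ∃ (I : NonemptyInterval (Fin n)) (p : Hom V (intervalModule K I))
      (s : Hom (intervalModule K I) V), ∀ x a, p.app x (s.app x a) = a := by
  classical
  let S : Finset (EquiorientedA n) := Finset.univ.filter fun x => Nontrivial (V.space x)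
  have hS : ∀ x, x ∈ S ↔ Nontrivial (V.space x) := fun x => by simp [S]
  obtain ⟨b, hbS, hb⟩ := S.exists_min_image EquiorientedA.val (hV.imp fun x => (hS x).2)
  have hbV := (hS b).1 hbS
  have hmin : ∀ x : EquiorientedA n, x.val < b.val → Subsingleton (V.space x) := fun x hx =>
    not_nontrivial_iff_subsingleton.1 fun h => absurd (hb x ((hS x).2 h)) (not_le.2 hx)
  obtain ⟨a, ha⟩ := exists_ne (0 : V.space b)
  let T : Finset (EquiorientedA n) := Finset.univ.filter fun m =>
    ∃ h : b.val ≤ m.val, V.pathMap h a ≠ 0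
  have hT : ∀ m, m ∈ T ↔ ∃ h : b.val ≤ m.val, V.pathMap h a ≠ 0 := fun m => by simp [T]
  -- The interval is `[b, m]`, with `b` the leftmost nonzero vertex and `m` the last vertex at which
  -- `a` survives. Minimality of `b` gives the morphism to it, maximality of `m` the morphism from
  -- it.
  obtain ⟨m, hmT, hm⟩ := T.exists_max_image EquiorientedA.val
    ⟨b, (hT b).2 ⟨le_rfl, by rwa [pathMap_self]⟩⟩
  obtain ⟨hbm, hne⟩ := (hT m).1 hmT
  have hmax : ∀ (y : EquiorientedA n) (h : b.val ≤ y.val), m.val + 1 = y.val →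
      V.pathMap h a = 0 := by
    intro y h hy
    by_contra hc
    have := hm y ((hT y).2 ⟨h, hc⟩)
    omega
  -- Normalising `l` on the image of `a` at `m` makes `p ∘ s` the identity at every vertex of the
  -- interval.
  obtain ⟨l, hl⟩ : ∃ l : V.space m →ₗ[K] K, l (V.pathMap hbm a) = 1 := by
    have := mt (Module.forall_dual_apply_eq_zero_iff K _).1 hne
    push Not at this
    obtain ⟨l, hl⟩ := this
    exact ⟨(l (V.pathMap hbm a))⁻¹ • l, inv_mul_cancel₀ hl⟩
  let I : NonemptyInterval (Fin n) := ⟨(b, m), hbm⟩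
  obtain ⟨p, hp⟩ := V.exists_hom_to_intervalModule I hmin l
  obtain ⟨s, hs⟩ := V.exists_hom_from_intervalModule I a hmax
  refine ⟨I, p, s, fun x f => intervalModule_ext fun hx => ?_⟩
  have h := V.pathMap_pathMap (i := b) (k := m) hx.1 hx.2 a
  rw [hp x hx, hs x hx, map_smul]
  refine (l.map_smul (f ⟨hx⟩) _).trans ?_
  rw [smul_eq_mul]
  exact (congrArg (fun c => f ⟨hx⟩ * c) ((congrArg l h).trans hl)).trans (mul_one _)

/-- Induction on the total dimension: the kernel of the retraction onto an interval module is
smaller. -/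
theorem exists_iso_directSum_intervalModule :
    ∃ (ι : Type) (_ : Finite ι) (J : ι → NonemptyInterval (Fin n)),
      Nonempty (Iso V (directSum fun i => intervalModule K (J i))) := by
  induction hd : V.totalDim using Nat.strong_induction_on generalizing V with
  | _ d ih =>
    by_cases hV : V.IsNonzero
    · obtain ⟨I, p, s, hps⟩ := V.exists_intervalModule_retract hV
      obtain ⟨x, hx⟩ := intervalModule_isNonzero (K := K) I
      obtain ⟨f, hf⟩ := exists_ne (0 : (intervalModule K I).space x)
      obtain ⟨ι, hι, J, ⟨φ⟩⟩ := ih _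
        (hd ▸ totalDim_infKer_lt p (x := x) (a := s.app x f) (by rwa [hps])) _ rfl
      exact ⟨Option ι, inferInstance, fun o => o.elim I J,
        nonempty_iso_directSum_option (W := fun o : Option ι => intervalModule K (o.elim I J))
          p s hps φ⟩
    · have hs : ∀ x, Subsingleton (V.space x) := fun x =>
        not_nontrivial_iff_subsingleton.1 fun h => hV ⟨x, h⟩
      refine ⟨Empty, inferInstance, Empty.elim,
        ⟨Iso.ofBijective (directSumLift fun i => i.elim) fun x => ⟨?_, ?_⟩⟩⟩
      · exact fun _ _ _ => (hs x).elim _ _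
      · exact fun f => ⟨0, funext fun i => i.elim⟩

/-- Every finite-dimensional representation of the equioriented quiver of type `A_n` is a direct
sum of interval modules. -/
theorem nonempty_barcodeDecomposition : Nonempty (BarcodeDecomposition V) := by
  obtain ⟨ι, hι, J, ⟨φ⟩⟩ := V.exists_iso_directSum_intervalModule
  -- The multiplicity of `I` is the size of the fibre of `J` over `I`.
  let e : (Σ I, Fin (Nat.card {i // J i = I})) ≃ ι :=
    (Equiv.sigmaCongrRight fun I => (Finite.equivFin {i // J i = I}).symm).trans
      (Equiv.sigmaFiberEquiv J)
  have he : ∀ k, J (e k) = k.1 := fun k => ((Finite.equivFin {i // J i = k.1}).symm k.2).2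
  obtain ⟨ψ⟩ := nonempty_iso_directSum_reindex e
    (W' := fun k => intervalModule K k.1) (fun k => by rw [he k]) φ
  exact ⟨⟨_, ψ⟩⟩

end Barcode

end QuiverRep

open QuiverRep in
theorem proposition5p2 {K : Type u} [Field K] {n : ℕ}
    (α : EquiorientedA n → ℝ) (hα : IsAntitoneSlope K α)
    (V : QuiverRep.{u, 0, w} K (EquiorientedA n)) (hV : V.IsNonzero) :
    Nonempty (BarcodeDecomposition V) ∧ Nonempty (HNFiltration α V) ∧
    ∀ (B : BarcodeDecomposition V) (F : HNFiltration α V),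
      (∀ t : ℝ,
        ∃ ψ : Iso (F.real t).toRep
            (directSum fun p : {p : (Σ I : NonemptyInterval (Fin n), Fin (B.d I)) //
                t ≤ QuiverRep.slope α (intervalModule K p.1)} => intervalModule K p.1.1),
          ∀ x (a : (F.real t).toRep.space x),
            B.iso.app x ((F.real t).incl.app x a) =
              (directSumIncl
                (fun p : (Σ I : NonemptyInterval (Fin n), Fin (B.d I)) => intervalModule K p.1)
                (fun p => t ≤ QuiverRep.slope α (intervalModule K p.1))).app x (ψ.app x a)) ∧
      ∀ j : Fin F.length,
        Nonempty (Iso (F.quot j)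
          (directSum fun p : {p : (Σ I : NonemptyInterval (Fin n), Fin (B.d I)) //
              QuiverRep.slope α (intervalModule K p.1) = QuiverRep.slope α (F.quot j)} => intervalModule K p.1.1)) := by
  have B₀ := V.nonempty_barcodeDecomposition
  refine ⟨B₀, ?_, fun B F => ⟨fun t => ?_, fun j => ?_⟩⟩
  · obtain ⟨B⟩ := B₀
    exact nonempty_hnFiltration_of_iso B.iso fun p => isSemistable_intervalModule hα p.1
  · rw [F.real_eq_partSum B.iso (fun p => isSemistable_intervalModule hα p.1) t]
    exact B.iso.exists_partSum_iso _
  · exact F.nonempty_quot_iso B.iso (fun p => isSemistable_intervalModule hα p.1) j
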